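/- **Proposition 3.** Let $\mathcal G$ be a connected undirected graph (no self-loops) with vertex set $\mathcal R=\{1,\dots,N_r\}$; write $\mathcal N_r$ for the set of neighbors of $r$. Let each node $r$ hold $\mathbf y_r\in\mathbb R^{n_r}$ and $\mathbf X_r\in\mathbb R^{n_r\times p}$. Vectors $\zeta\in\mathbb R^p$ are partitioned into $N_b$ subvectors, $\zeta=[\zeta_1',\dots,\zeta_{N_b}']'$ with $\zeta_\nu\in\mathbb R^{p_\nu}$, $\sum_\nu p_\nu=p$. Let $\mu\ge 0$, and consider the group-Lasso problem $$\min_{\zeta\in\mathbb R^p}\ \frac12\sum_{r=1}^{N_r}\|\mathbf y_r-\mathbf X_r\zeta\|_2^2+\mu\sum_{\nu=1}^{N_b}\|\zeta_\nu\|_2 .\qquad(\ast)$$ Let $\mathcal T_\mu(\mathbf a)=\frac{\mathbf a}{\|\mathbf a\|_2}\max\{\|\mathbf a\|_2-\mu,0\}$, with $\mathcal T_\mu(\mathbf 0)=\mathbf 0$, let $c>0$, and consider the DGLasso recursions, for $k=0,1,2,\dots$ and all $r\in\mathcal R$, $$\mathbf p_r(k)=\mathbf p_r(k-1)+c\sum_{r'\in\mathcal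 N_r}[\zeta_r(k)-\zeta_{r'}(k)],\qquad \mathbf v_r(k)=\mathbf v_r(k-1)+c[\zeta_r(k)-\gamma_r(k)],$$ $$\zeta_{r\nu}(k+1)=\frac{\mathcal T_\mu\!\left(N_r\left(c\gamma_{r\nu}(k)+c\sum_{r'\in\mathcal N_r}[\zeta_{r\nu}(k)+\zeta_{r'\nu}(k)]-\mathbf p_{r\nu}(k)-\mathbf v_{r\nu}(k)\right)\right)}{cN_r(2|\mathcal N_r|+1)},\quad \nu=1,\dots,N_b,$$ $$\gamma_r(k+1)=\left[c\mathbf I_p+\mathbf X_r'\mathbf X_r\right]^{-1}\left(\mathbf X_r'\mathbf y_r+c\,\zeta_r(k+1)+\mathbf v_r(k)\right),$$ where $\zeta_r(0),\gamma_r(0),\mathbf v_r(-1)\in\mathbb R^p$ are arbitrary and the $\mathbf p_r(-1)\in\mathbb R^p$ satisfy $\sum_{r\in\mathcal R}\mathbf p_r(-1)=\mathbf 0$ (for instance, everything is initialized to zero). (In the recursions, $N_r$ as a scalar is the number of nodes and $\mathcal N_r$ is a neighborhood.) Then, for any step size $c>0$, there is a minimizer $\hat\zeta$ of $(\ast)$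 such that $\lim_{k\to\infty}\zeta_r(k)=\hat\zeta$ for every $r\in\mathcal R$. In particular, if $(\ast)$ has a unique solution $\hat\zeta_{\mathrm{glasso}}$, then $\lim_{k\to\infty}\zeta_r(k)=\hat\zeta_{\mathrm{glasso}}$ for every $r\in\mathcal R$. -/

import Mathlib

open scoped Matrix

namespace DGLasso

noncomputable section

/-- The parameter space `ℝᵖ` (Euclidean norm), with coordinates arranged into `Nb` groups,
group `ν` having `d ν` coordinates, so `p = ∑ ν, d ν`. -/
abbrev Param {Nb : ℕ} (d : Fin Nb → ℕ) : Type :=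
  EuclideanSpace ℝ (Σ ν : Fin Nb, Fin (d ν))

/-- The `ν`-th subvector `ζ_ν` of `ζ = [ζ_1', …, ζ_{Nb}']'`. -/
def group {Nb : ℕ} {d : Fin Nb → ℕ} (z : Param d) (ν : Fin Nb) :
    EuclideanSpace ℝ (Fin (d ν)) :=
  WithLp.toLp 2 fun j => z ⟨ν, j⟩

/-- The vector soft-thresholding operator `T_μ(a) = (a / ‖a‖) (‖a‖ - μ)_+`
(with value `0` at `a = 0`). -/
def softThreshold (μ : ℝ) {m : ℕ} (a : EuclideanSpace ℝ (Fin m)) :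
    EuclideanSpace ℝ (Fin m) :=
  max (‖a‖ - μ) 0 • (‖a‖⁻¹ • a)

/-- The group-Lasso cost `(1/2) ∑_r ‖y_r - X_r ζ‖² + μ ∑_ν ‖ζ_ν‖`. -/
def cost {Nr Nb : ℕ} {d : Fin Nb → ℕ} {n : Fin Nr → ℕ}
    (y : (r : Fin Nr) → EuclideanSpace ℝ (Fin (n r)))
    (X : (r : Fin Nr) → Matrix (Fin (n r)) (Σ ν : Fin Nb, Fin (d ν)) ℝ)
    (μ : ℝ) (z : Param d) : ℝ :=
  1 / 2 * ∑ r, ‖y r - WithLp.toLp 2 (X r *ᵥ z.ofLp)‖ ^ 2 + μ * ∑ ν, ‖group z ν‖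

/-- The set of minimizers of the group-Lasso cost. -/
def solutionSet {Nr Nb : ℕ} {d : Fin Nb → ℕ} {n : Fin Nr → ℕ}
    (y : (r : Fin Nr) → EuclideanSpace ℝ (Fin (n r)))
    (X : (r : Fin Nr) → Matrix (Fin (n r)) (Σ ν : Fin Nb, Fin (d ν)) ℝ)
    (μ : ℝ) : Set (Param d) :=
  {z | ∀ w : Param d, cost y X μ z ≤ cost y X μ w}

/-- The variables held by the nodes at the beginning of iteration `k`:
`ζ_r(k)`, `γ_r(k)`, `p_r(k-1)` and `v_r(k-1)`, for all nodes `r`. -/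
structure State (Nr : ℕ) {Nb : ℕ} (d : Fin Nb → ℕ) where
  ζ : Fin Nr → Param d
  γ : Fin Nr → Param d
  p : Fin Nr → Param d
  v : Fin Nr → Param d

section Step

variable {Nr Nb : ℕ} {d : Fin Nb → ℕ} {n : Fin Nr → ℕ}
  (G : SimpleGraph (Fin Nr)) [DecidableRel G.Adj]
  (y : (r : Fin Nr) → EuclideanSpace ℝ (Fin (n r)))
  (X : (r : Fin Nr) → Matrix (Fin (n r)) (Σ ν : Fin Nb, Fin (d ν)) ℝ)
  (μ c : ℝ) (s : State Nr d)

/-- `p_r(k) = p_r(k-1) + c ∑_{r' ∈ N_r} [ζ_r(k) - ζ_{r'}(k)]`. -/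
def nextP (r : Fin Nr) : Param d :=
  s.p r + c • ∑ r' ∈ G.neighborFinset r, (s.ζ r - s.ζ r')

/-- `v_r(k) = v_r(k-1) + c [ζ_r(k) - γ_r(k)]`. -/
def nextV (r : Fin Nr) : Param d :=
  s.v r + c • (s.ζ r - s.γ r)

/-- `ζ_{rν}(k+1) = T_μ(Nr (c γ_{rν}(k) + c ∑_{r' ∈ N_r} [ζ_{rν}(k) + ζ_{r'ν}(k)]
- p_{rν}(k) - v_{rν}(k))) / (c Nr (2 |N_r| + 1))` for every group `ν`. -/
def nextZeta (r : Fin Nr) : Param d :=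
  WithLp.toLp 2 fun i =>
    ((c * (Nr : ℝ) * (2 * (G.degree r : ℝ) + 1))⁻¹ •
      softThreshold μ ((Nr : ℝ) •
        group (c • s.γ r + c • ∑ r' ∈ G.neighborFinset r, (s.ζ r + s.ζ r')
          - nextP G c s r - nextV c s r) i.1)) i.2

/-- `γ_r(k+1) = [c I_p + X_r' X_r]⁻¹ (X_r' y_r + c ζ_r(k+1) + v_r(k))`. -/
def nextGamma (r : Fin Nr) : Param d :=
  WithLp.toLp 2
    ((c • (1 : Matrix (Σ ν : Fin Nb, Fin (d ν)) (Σ ν : Fin Nb, Fin (d ν)) ℝ)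
        + (X r)ᵀ * X r)⁻¹ *ᵥ
      ((X r)ᵀ *ᵥ (y r).ofLp + (c • nextZeta G μ c s r + nextV c s r).ofLp))

/-- One full iteration of the algorithm, run at all the nodes. -/
def step : State Nr d where
  ζ := nextZeta G μ c s
  γ := nextGamma G y X μ c s
  p := nextP G c s
  v := nextV c s

/-- The state `(ζ(k), γ(k), p(k-1), v(k-1))` after `k` iterations from the initial state
`s = (ζ(0), γ(0), p(-1), v(-1))`. -/
def iterates : ℕ → State Nr d
  | 0 => s
  | k + 1 => step G y X μ c (iterates k)

end Step

end

end DGLasso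

/-! ### Abstract splitting iteration in a Euclidean space -/

section Splitting

open Filter Topology

variable {H : Type*} [NormedAddCommGroup H] [InnerProductSpace ℝ H]

/-! The recursion is an ADMM scheme. Stacking the node variables, let `L` be the graph Laplacian and
`Q` the signless Laplacian. Since `L + Q` is twice the degree operator, soft-thresholding solves an
inclusion whose quadratic coupling is diagonal (`nextZeta_isSubgradient`), while the normal
equations for `γ` say that `v` is the local least-squares gradient at `γ`
(`leastSquaresGrad_nextGamma`).

Relative to any saddle point, monotonicity of both operators makes `lyapunov` nonincreasing
(`lyapunov_descent`), with a drop that forces `L x`, `x - g` and the increments of `g` to zero.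
Bounded iterates then have a cluster point, which is again a saddle point. Taking it as the
reference point, the Lyapunov function tends to zero along a subsequence, hence along the whole
sequence: this is Opial's argument.

On a connected graph `ker L` is the consensus space and `range L` consists of the families with zero
sum. Thus a saddle point is a common value `z` at which the summed local inclusions are the
optimality condition of the group Lasso. -/

theorem exists_linearMap_comp_comp_eq {V : Type*} [AddCommGroup V] [Module ℝ V]
    (L : V →ₗ[ℝ] V) : ∃ K : V →ₗ[ℝ] V, ∀ x, L (K (L x)) = L x := by
  obtain ⟨g, hg⟩ := L.rangeRestrict.exists_rightInverse_of_surjective L.range_rangeRestrict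
  obtain ⟨K, hK⟩ := LinearMap.exists_extend g
  refine ⟨K, fun x => ?_⟩
  have h1 : K (L x) = g (L.rangeRestrict x) := by
    rw [← hK]; rfl
  have h2 := congrArg Subtype.val (LinearMap.congr_fun hg (L.rangeRestrict x))
  simpa [h1] using h2

/-- Expand the nonnegative form at `x - t • L x` with `t = ‖L‖⁻¹`. This turns a vanishing or bounded
form into control of `L x` itself. -/
theorem norm_sq_apply_le_of_symmetric_nonneg (L : H →L[ℝ] H)
    (hsymm : ∀ x y, inner ℝ (L x) y = inner ℝ x (L y)) (hpos : ∀ x, 0 ≤ inner ℝ (L x) x) (x : H) :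
    ‖L x‖ ^ 2 ≤ ‖L‖ * inner ℝ (L x) x := by
  have key : ∀ t : ℝ, 0 ≤ inner ℝ (L x) x - 2 * t * ‖L x‖ ^ 2 + t ^ 2 * inner ℝ (L (L x)) (L x) := by
    intro t
    have h := hpos (x - t • L x)
    have e : inner ℝ (L (L x)) x = ‖L x‖ ^ 2 := by
      rw [hsymm, real_inner_self_eq_norm_sq]
    simp only [map_sub, map_smul, inner_sub_left, inner_sub_right, real_inner_smul_left,
      real_inner_smul_right, e, real_inner_self_eq_norm_sq] at h
    linarith
  have hb : inner ℝ (L (L x)) (L x) ≤ ‖L‖ * ‖L x‖ ^ 2 := by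
    calc inner ℝ (L (L x)) (L x) ≤ ‖L (L x)‖ * ‖L x‖ := real_inner_le_norm _ _
      _ ≤ (‖L‖ * ‖L x‖) * ‖L x‖ := by gcongr; exact L.le_opNorm _
      _ = _ := by ring
  rcases (norm_nonneg L).eq_or_lt with h0 | h0
  · have : L x = 0 := by
      have := L.le_opNorm x
      rw [← h0, zero_mul] at this
      exact norm_le_zero_iff.1 this
    simp [this]
  · have h := key (‖L‖⁻¹)
    have h2 : (‖L‖⁻¹) ^ 2 * inner ℝ (L (L x)) (L x) ≤ (‖L‖⁻¹) ^ 2 * (‖L‖ * ‖L x‖ ^ 2) := by gcongr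
    have h3 : (‖L‖⁻¹) ^ 2 * (‖L‖ * ‖L x‖ ^ 2) = ‖L‖⁻¹ * ‖L x‖ ^ 2 := by
      field_simp
    have h4 : ‖L‖⁻¹ * ‖L x‖ ^ 2 ≤ inner ℝ (L x) x := by linarith
    rwa [inv_mul_le_iff₀ h0] at h4

theorem inner_apply_sub_left_of_symmetric (Q : H →L[ℝ] H)
    (hQ : ∀ x y, inner ℝ (Q x) y = inner ℝ x (Q y)) (a b : H) :
    2 * inner ℝ (Q (a - b)) b
      = inner ℝ (Q a) a - inner ℝ (Q b) b - inner ℝ (Q (a - b)) (a - b) := by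
  have : inner ℝ (Q b) a = inner ℝ (Q a) b := by rw [hQ, real_inner_comm]
  simp only [map_sub, inner_sub_left, inner_sub_right]
  linarith

/-- The Lyapunov function of the splitting iteration, relative to a saddle point `(z, p₀)`. -/
noncomputable def lyapunov (Q K : H →L[ℝ] H) (c : ℝ) (z p₀ v₀ : H) (x g p v : H) : ℝ :=
  c⁻¹ * ‖v - v₀‖ ^ 2 + c⁻¹ * inner ℝ (p - p₀) (K (p - p₀)) + c * ‖g - z‖ ^ 2
    + c * inner ℝ (Q (x - z)) (x - z)

/-- Add twice `h1`, `h2` and `h3` and polarize. Because `c • (x' - g') = v' - v`, replacing `x' - z`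
by `g' - z` creates the cross term `inner ℝ (v' - v) (g' - g)`, which `h3` controls. Polarizing the
`p` term leaves the dissipation `c * inner ℝ (L x') x'`; the nonnegative `Q` dissipation is
discarded. -/
theorem lyapunov_descent {L Q K : H →L[ℝ] H} {c : ℝ} (hc : 0 < c)
    (hL : ∀ x y, inner ℝ (L x) y = inner ℝ x (L y)) (hK : ∀ x, L (K (L x)) = L x)
    (hQ : ∀ x y, inner ℝ (Q x) y = inner ℝ x (Q y)) (hQ0 : ∀ x, 0 ≤ inner ℝ (Q x) x)
    {z p₀ v₀ x g p v x' g' p' v' a : H} (hz : L z = 0) (hp : p - p₀ = L a)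
    (hp' : p' = p + c • L x') (hv' : v' = v + c • (x' - g'))
    (h1 : 0 ≤ inner ℝ ((-p' - v' + c • (g - g') + c • Q (x - x')) - (-p₀ - v₀)) (x' - z))
    (h2 : 0 ≤ inner ℝ (v' - v₀) (g' - z)) (h3 : 0 ≤ inner ℝ (v' - v) (g' - g)) :
    lyapunov Q K c z p₀ v₀ x' g' p' v'
      + (c⁻¹ * ‖v' - v‖ ^ 2 + c * inner ℝ (L x') x' + c * ‖g' - g‖ ^ 2)
      ≤ lyapunov Q K c z p₀ v₀ x g p v := by
  have hp2 : p' - p₀ = L (a + c • x') := by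
    rw [hp', map_add, map_smul, ← hp]; abel
  have hin : ∀ b, inner ℝ (L b) (K (L b)) = inner ℝ (L b) b := fun b => by
    rw [hL, hK, ← hL]
  have hLz : ∀ b, inner ℝ (L b) z = 0 := fun b => by rw [hL, hz, inner_zero_right]
  have eP : c⁻¹ * inner ℝ (L (a + c • x')) (a + c • x') - c⁻¹ * inner ℝ (L a) a
      = 2 * inner ℝ (L (a + c • x')) x' - c * inner ℝ (L x') x' := by
    have e : inner ℝ (L x') a = inner ℝ (L a) x' := by rw [hL, real_inner_comm]
    simp only [map_add, map_smul, inner_add_left, inner_add_right, real_inner_smul_left,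
      real_inner_smul_right, e]
    field_simp
    ring
  have eQ := inner_apply_sub_left_of_symmetric Q hQ (x - z) (x' - z)
  rw [sub_sub_sub_cancel_right] at eQ
  have hQd := hQ0 (x - x')
  have hxg : x' - g' = c⁻¹ • (v' - v) := by
    rw [hv', add_sub_cancel_left, smul_smul, inv_mul_cancel₀ hc.ne', one_smul]
  have hxz : x' - z = c⁻¹ • (v' - v) + (g' - z) := by rw [← hxg]; abel
  have e1 : inner ℝ (v' - v₀) (x' - z)
      = c⁻¹ * inner ℝ (v' - v₀) (v' - v) + inner ℝ (v' - v₀) (g' - z) := by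
    rw [hxz, inner_add_right, real_inner_smul_right]
  have e2 : c * inner ℝ (g - g') (x' - z)
      = - inner ℝ (v' - v) (g' - g) + c * inner ℝ (g - g') (g' - z) := by
    rw [hxz, inner_add_right, real_inner_smul_right, mul_add, ← mul_assoc,
      mul_inv_cancel₀ hc.ne', one_mul, real_inner_comm, ← inner_neg_right, neg_sub]
  have e3 : 2 * inner ℝ (v' - v₀) (v' - v)
      = ‖v' - v₀‖ ^ 2 + ‖v' - v‖ ^ 2 - ‖v - v₀‖ ^ 2 := by
    have := norm_sub_sq_real (v' - v₀) (v' - v)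
    rw [sub_sub_sub_cancel_left] at this
    linarith
  have e4 : 2 * inner ℝ (g - g') (g' - z)
      = ‖g - z‖ ^ 2 - ‖g' - g‖ ^ 2 - ‖g' - z‖ ^ 2 := by
    have := norm_add_sq_real (g - g') (g' - z)
    rw [sub_add_sub_cancel, norm_sub_rev g g'] at this
    linarith
  have e5 : inner ℝ ((-p' - v' + c • (g - g') + c • Q (x - x')) - (-p₀ - v₀)) (x' - z)
      = - inner ℝ (L (a + c • x')) x' - inner ℝ (v' - v₀) (x' - z)
        + c * inner ℝ (g - g') (x' - z) + c * inner ℝ (Q (x - x')) (x' - z) := by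
    have : (-p' - v' + c • (g - g') + c • Q (x - x')) - (-p₀ - v₀)
        = - (p' - p₀) - (v' - v₀) + c • (g - g') + c • Q (x - x') := by abel
    rw [this, inner_add_left, inner_add_left, inner_sub_left, inner_neg_left, hp2,
      real_inner_smul_left, real_inner_smul_left, inner_sub_right (L _) x' z, hLz, sub_zero]
  rw [e5, e1, e2] at h1
  unfold lyapunov
  rw [hp2, hp, hin, hin]
  have hci : c⁻¹ * (2 * inner ℝ (v' - v₀) (v' - v))
      = c⁻¹ * (‖v' - v₀‖ ^ 2 + ‖v' - v‖ ^ 2 - ‖v - v₀‖ ^ 2) := by rw [e3]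
  have hcg : c * (2 * inner ℝ (g - g') (g' - z))
      = c * (‖g - z‖ ^ 2 - ‖g' - g‖ ^ 2 - ‖g' - z‖ ^ 2) := by rw [e4]
  have hcq : c * (2 * inner ℝ (Q (x - x')) (x' - z))
      = c * (inner ℝ (Q (x - z)) (x - z) - inner ℝ (Q (x' - z)) (x' - z)
        - inner ℝ (Q (x - x')) (x - x')) := by rw [eQ]
  have := mul_nonneg hc.le hQd
  linarith

theorem tendsto_zero_of_add_le {V D : ℕ → ℝ} (hV : ∀ k, 0 ≤ V k) (hD : ∀ k, 0 ≤ D k)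
    (h : ∀ k, V (k + 1) + D k ≤ V k) : Antitone V ∧ Tendsto D atTop (𝓝 0) := by
  have ha : Antitone V := antitone_nat_of_succ_le fun k => by linarith [h k, hD k]
  refine ⟨ha, ?_⟩
  have ht := tendsto_atTop_ciInf ha ⟨0, by rintro _ ⟨k, rfl⟩; exact hV k⟩
  have ht' := ht.sub (ht.comp (tendsto_add_atTop_nat 1))
  rw [sub_self] at ht'
  exact squeeze_zero hD (fun k => by simp only [Function.comp_apply]; linarith [h k]) ht'

theorem tendsto_zero_of_norm_sq_le {E : Type*} [SeminormedAddCommGroup E] {f : ℕ → E} {D : ℕ → ℝ}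
    {C : ℝ} (h : ∀ k, ‖f k‖ ^ 2 ≤ C * D k) (hD : Tendsto D atTop (𝓝 0)) :
    Tendsto f atTop (𝓝 0) := by
  have h0 : Tendsto (fun k => ‖f k‖ ^ 2) atTop (𝓝 0) :=
    squeeze_zero (fun k => by positivity) h (by simpa using hD.const_mul C)
  have h1 := h0.sqrt
  simp only [Real.sqrt_sq (norm_nonneg _), Real.sqrt_zero] at h1
  exact tendsto_zero_iff_norm_tendsto_zero.2 h1

/-- Convergence of the alternating direction iteration for the monotone inclusion
`-p - φ z ∈ B z`, `p ∈ range L`, `z ∈ ker L`. -/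
theorem exists_tendsto_of_splitting_iteration [FiniteDimensional ℝ H] {L Q : H →L[ℝ] H}
    {c : ℝ} (hc : 0 < c)
    (hL : ∀ x y, inner ℝ (L x) y = inner ℝ x (L y)) (hL0 : ∀ x, 0 ≤ inner ℝ (L x) x)
    (hQ : ∀ x y, inner ℝ (Q x) y = inner ℝ x (Q y)) (hQ0 : ∀ x, 0 ≤ inner ℝ (Q x) x)
    {φ : H → H} (hφ : ∀ x y, 0 ≤ inner ℝ (φ x - φ y) (x - y)) (hφc : Continuous φ)
    {B : H → H → Prop} (hB : ∀ x y s t, B x s → B y t → 0 ≤ inner ℝ (s - t) (x - y))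
    (hBc : ∀ (x s : ℕ → H) (x₀ s₀ : H), Tendsto x atTop (𝓝 x₀) → Tendsto s atTop (𝓝 s₀) →
      (∀ k, B (x k) (s k)) → B x₀ s₀)
    {x g p v : ℕ → H} (hp0 : p 0 ∈ Set.range L)
    (hp : ∀ k, p (k + 1) = p k + c • L (x (k + 1)))
    (hv : ∀ k, v (k + 1) = v k + c • (x (k + 1) - g (k + 1)))
    (hvφ : ∀ k, v k = φ (g k))
    (hx : ∀ k, B (x (k + 1)) (-p (k + 1) - v (k + 1) + c • (g k - g (k + 1))
      + c • Q (x k - x (k + 1))))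
    (hsaddle : ∃ z p₀, L z = 0 ∧ p₀ ∈ Set.range L ∧ B z (-p₀ - φ z)) :
    ∃ z p₀, L z = 0 ∧ p₀ ∈ Set.range L ∧ B z (-p₀ - φ z) ∧ Tendsto x atTop (𝓝 z) := by
  -- A generalized inverse suffices: on `range L`, where `p - p₀` lives, the form of `K` at `L b` is
  -- `inner ℝ (L b) b`, so it is nonnegative.
  obtain ⟨K₀, hK₀⟩ := exists_linearMap_comp_comp_eq (L : H →ₗ[ℝ] H)
  set K : H →L[ℝ] H := K₀.toContinuousLinearMap with hKdef
  have hK : ∀ y, L (K (L y)) = L y := hK₀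
  have hci : 0 < c⁻¹ := inv_pos.2 hc
  have hprange : ∀ k, ∃ b, p k = L b := by
    intro k
    induction k with
    | zero => obtain ⟨b, hb⟩ := hp0; exact ⟨b, hb.symm⟩
    | succ k ih =>
      obtain ⟨b, hb⟩ := ih
      exact ⟨b + c • x (k + 1), by rw [hp, hb, map_add, map_smul]⟩
  have hin : ∀ b, inner ℝ (L b) (K (L b)) = inner ℝ (L b) b := fun b => by
    rw [hL, hK, ← hL]
  -- consequences of the descent inequality for an arbitrary saddle point
  have main : ∀ z p₀, L z = 0 → p₀ ∈ Set.range L → B z (-p₀ - φ z) →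
      (∀ k, 0 ≤ inner ℝ (p k - p₀) (K (p k - p₀)) ∧
        ‖p k - p₀‖ ^ 2 ≤ ‖L‖ * inner ℝ (p k - p₀) (K (p k - p₀))) ∧
      Antitone (fun k => lyapunov Q K c z p₀ (φ z) (x k) (g k) (p k) (v k)) ∧
      Tendsto (fun k => c⁻¹ * ‖v (k + 1) - v k‖ ^ 2 + c * inner ℝ (L (x (k + 1))) (x (k + 1))
        + c * ‖g (k + 1) - g k‖ ^ 2) atTop (𝓝 0) := by
    rintro z p₀ hz ⟨b₀, hb₀⟩ hBz
    have hpd : ∀ k, ∃ a, p k - p₀ = L a := fun k => by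
      obtain ⟨b, hb⟩ := hprange k
      exact ⟨b - b₀, by rw [hb, ← hb₀, map_sub]⟩
    have hpos : ∀ k, 0 ≤ inner ℝ (p k - p₀) (K (p k - p₀)) ∧
        ‖p k - p₀‖ ^ 2 ≤ ‖L‖ * inner ℝ (p k - p₀) (K (p k - p₀)) := fun k => by
      obtain ⟨a, ha⟩ := hpd k
      rw [ha, hin]
      exact ⟨hL0 a, norm_sq_apply_le_of_symmetric_nonneg L hL hL0 a⟩
    refine ⟨hpos, tendsto_zero_of_add_le (fun k => ?_) (fun k => ?_) fun k => ?_⟩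
    · have := (hpos k).1
      have := hQ0 (x k - z)
      unfold lyapunov
      positivity
    · have := hL0 (x (k + 1))
      positivity
    · obtain ⟨a, ha⟩ := hpd k
      refine lyapunov_descent hc hL hK hQ hQ0 hz ha (hp k) (hv k) (hB _ _ _ _ (hx k) hBz) ?_ ?_
      · rw [hvφ]; exact hφ _ _
      · rw [hvφ, hvφ]; exact hφ _ _
  have hpart : ∀ z p₀ k, (∀ k, 0 ≤ inner ℝ (p k - p₀) (K (p k - p₀))) →
      c * ‖g k - z‖ ^ 2 ≤ lyapunov Q K c z p₀ (φ z) (x k) (g k) (p k) (v k) ∧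
      c⁻¹ * inner ℝ (p k - p₀) (K (p k - p₀))
        ≤ lyapunov Q K c z p₀ (φ z) (x k) (g k) (p k) (v k) := by
    intro z p₀ k h
    have h1 := mul_nonneg hci.le (h k)
    have h2 := mul_nonneg hc.le (hQ0 (x k - z))
    have h3 : 0 ≤ c⁻¹ * ‖v k - φ z‖ ^ 2 := by positivity
    have h4 : 0 ≤ c * ‖g k - z‖ ^ 2 := by positivity
    unfold lyapunov
    constructor <;> linarith
  -- residuals vanish and the iterates are bounded
  obtain ⟨z₁, p₁, hz₁, hp₁, hB₁⟩ := hsaddle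
  obtain ⟨hpos₁, hanti₁, hres⟩ := main z₁ p₁ hz₁ hp₁ hB₁
  have hvres : Tendsto (fun k => v (k + 1) - v k) atTop (𝓝 0) := by
    refine tendsto_zero_of_norm_sq_le (C := c) (fun k => ?_) hres
    have h1 : 0 ≤ c * inner ℝ (L (x (k + 1))) (x (k + 1)) := mul_nonneg hc.le (hL0 _)
    have h2 : 0 ≤ c * ‖g (k + 1) - g k‖ ^ 2 := by positivity
    rw [← inv_mul_le_iff₀ hc]; linarith
  have hgres : Tendsto (fun k => g (k + 1) - g k) atTop (𝓝 0) := by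
    refine tendsto_zero_of_norm_sq_le (C := c⁻¹) (fun k => ?_) hres
    have h1 : 0 ≤ c * inner ℝ (L (x (k + 1))) (x (k + 1)) := mul_nonneg hc.le (hL0 _)
    have h2 : 0 ≤ c⁻¹ * ‖v (k + 1) - v k‖ ^ 2 := by positivity
    rw [le_inv_mul_iff₀ hc]; linarith
  have hLres : Tendsto (fun k => L (x (k + 1))) atTop (𝓝 0) := by
    refine tendsto_zero_of_norm_sq_le (C := ‖L‖ * c⁻¹) (fun k => ?_) hres
    refine (norm_sq_apply_le_of_symmetric_nonneg L hL hL0 _).trans ?_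
    rw [mul_assoc]
    gcongr
    have h1 : 0 ≤ c * ‖g (k + 1) - g k‖ ^ 2 := by positivity
    have h2 : 0 ≤ c⁻¹ * ‖v (k + 1) - v k‖ ^ 2 := by positivity
    rw [le_inv_mul_iff₀ hc]; linarith
  have hxg1 : Tendsto (fun k => x (k + 1) - g (k + 1)) atTop (𝓝 0) := by
    have h := hvres.const_smul c⁻¹
    rw [smul_zero] at h
    refine h.congr fun k => ?_
    rw [hv, add_sub_cancel_left, smul_smul, inv_mul_cancel₀ hc.ne', one_smul]
  have hxg : Tendsto (fun k => x k - g k) atTop (𝓝 0) :=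
    (tendsto_add_atTop_iff_nat (f := fun k => x k - g k) 1).1 hxg1
  -- `Q` may be degenerate, so this comes from the increments of `g` and from `x - g → 0`, not from
  -- a `Q` term.
  have hxres : Tendsto (fun k => x k - x (k + 1)) atTop (𝓝 0) := by
    have h := (hxg.sub hxg1).sub hgres
    simp only [sub_zero] at h
    refine h.congr fun k => ?_
    abel
  have hbdd : ∃ R, ∀ k, (g k, p k) ∈ Metric.closedBall (z₁, p₁) R := by
    set V₀ := lyapunov Q K c z₁ p₁ (φ z₁) (x 0) (g 0) (p 0) (v 0)
    refine ⟨max (Real.sqrt (c⁻¹ * V₀)) (Real.sqrt (‖L‖ * (c * V₀))), fun k => ?_⟩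
    obtain ⟨h1, h2⟩ := hpart z₁ p₁ k fun k => (hpos₁ k).1
    have h3 : lyapunov Q K c z₁ p₁ (φ z₁) (x k) (g k) (p k) (v k) ≤ V₀ := hanti₁ (Nat.zero_le k)
    rw [Metric.mem_closedBall, Prod.dist_eq]
    refine max_le_max ?_ ?_
    · rw [dist_eq_norm]
      refine Real.le_sqrt_of_sq_le ?_
      rw [le_inv_mul_iff₀ hc]; linarith
    · rw [dist_eq_norm]
      refine Real.le_sqrt_of_sq_le ((hpos₁ k).2.trans ?_)
      gcongr
      rw [← inv_mul_le_iff₀ hc]; linarith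
  obtain ⟨R, hR⟩ := hbdd
  -- Only `g` and `p` need compactness: `v = φ g`, and `x - g → 0`. The shift by one is there
  -- because `hx` holds at `k + 1`.
  obtain ⟨⟨z, p₀⟩, -, σ, hσ, hlim⟩ := (isCompact_closedBall (z₁, p₁) R).tendsto_subseq
    (x := fun k => (g (k + 1), p (k + 1))) fun k => hR (k + 1)
  have hglim : Tendsto (fun j => g (σ j + 1)) atTop (𝓝 z) := (continuous_fst.tendsto _).comp hlim
  have hplim : Tendsto (fun j => p (σ j + 1)) atTop (𝓝 p₀) := (continuous_snd.tendsto _).comp hlim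
  have hσt := hσ.tendsto_atTop
  have hxlim : Tendsto (fun j => x (σ j + 1)) atTop (𝓝 z) := by
    have h := (hxg1.comp hσt).add hglim
    simpa using h
  have hvlim : Tendsto (fun j => v (σ j + 1)) atTop (𝓝 (φ z)) := by
    simp only [hvφ]
    exact (hφc.tendsto z).comp hglim
  have hz : L z = 0 :=
    tendsto_nhds_unique ((L.continuous.tendsto z).comp hxlim) (hLres.comp hσt)
  have hp₀ : p₀ ∈ Set.range L := by
    have hcl : IsClosed (Set.range L) :=
      Submodule.closed_of_finiteDimensional (LinearMap.range (L : H →ₗ[ℝ] H))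
    refine hcl.mem_of_tendsto hplim (Eventually.of_forall fun j => ?_)
    obtain ⟨b, hb⟩ := hprange (σ j + 1)
    exact ⟨b, hb.symm⟩
  have hBz : B z (-p₀ - φ z) := by
    refine hBc _ _ _ _ hxlim ?_ fun j => hx (σ j)
    have h1 := (hgres.comp hσt).neg.const_smul c
    have h2 := ((Q.continuous.tendsto 0).comp (hxres.comp hσt)).const_smul c
    have h := ((hplim.neg.sub hvlim).add h1).add h2
    simpa using h
  refine ⟨z, p₀, hz, hp₀, hBz, ?_⟩
  -- The cluster point now replaces the initial saddle point as reference; monotonicity upgrades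
  -- subsequential to full convergence.
  obtain ⟨hpos, hanti, -⟩ := main z p₀ hz hp₀ hBz
  have hVsub : Tendsto (fun j => lyapunov Q K c z p₀ (φ z) (x (σ j + 1)) (g (σ j + 1))
      (p (σ j + 1)) (v (σ j + 1))) atTop (𝓝 0) := by
    have hcont : Continuous fun w : H × H × H × H =>
        lyapunov Q K c z p₀ (φ z) w.1 w.2.1 w.2.2.1 w.2.2.2 := by
      unfold lyapunov
      fun_prop
    have h := (hcont.tendsto (z, z, p₀, φ z)).comp
      (hxlim.prodMk_nhds (hglim.prodMk_nhds (hplim.prodMk_nhds hvlim)))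
    simpa [lyapunov, Function.comp_def] using h
  have hV0 : ∀ k, 0 ≤ lyapunov Q K c z p₀ (φ z) (x k) (g k) (p k) (v k) := fun k =>
    le_trans (by positivity) (hpart z p₀ k fun k => (hpos k).1).1
  have hVlim := tendsto_atTop_ciInf hanti ⟨0, by rintro _ ⟨k, rfl⟩; exact hV0 k⟩
  have hV := tendsto_nhds_unique
    (hVlim.comp ((tendsto_add_atTop_nat 1).comp hσt)) hVsub
  rw [hV] at hVlim
  have hg : Tendsto (fun k => g k - z) atTop (𝓝 0) := by
    refine tendsto_zero_of_norm_sq_le (C := c⁻¹) (fun k => ?_) hVlim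
    rw [le_inv_mul_iff₀ hc]
    exact (hpart z p₀ k fun k => (hpos k).1).1
  have h := (hxg.add hg).add_const z
  simpa using h

end Splitting

/-! ### Laplacian and signless Laplacian of a graph -/

section GraphOperators

variable {V : Type*} [Fintype V] (G : SimpleGraph V) [DecidableRel G.Adj]
  {E : Type*} [NormedAddCommGroup E] [InnerProductSpace ℝ E]

theorem sum_neighborFinset_comm {M : Type*} [AddCommMonoid M] (F : V → V → M) :
    ∑ r, ∑ r' ∈ G.neighborFinset r, F r r' = ∑ r, ∑ r' ∈ G.neighborFinset r, F r' r :=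
  Finset.sum_comm' fun r r' => by simp [G.adj_comm]

/-- The operator `(M x)_r = ∑_{r' ∼ r} (x_r + ε x_{r'})`: the graph Laplacian for `ε = -1`, the
signless Laplacian for `ε = 1`. -/
def signedLaplacian (ε : ℝ) : PiLp 2 (fun _ : V => E) →ₗ[ℝ] PiLp 2 (fun _ : V => E) where
  toFun x := WithLp.toLp 2 fun r => ∑ r' ∈ G.neighborFinset r, (x r + ε • x r')
  map_add' x y := by
    ext1 r
    simp only [PiLp.add_apply, ← Finset.sum_add_distrib]
    refine Finset.sum_congr rfl fun r' _ => ?_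
    rw [smul_add]; abel
  map_smul' a x := by
    ext1 r
    simp only [PiLp.smul_apply, RingHom.id_apply, Finset.smul_sum, smul_add]
    simp only [smul_comm ε a]

@[simp]
theorem signedLaplacian_apply (ε : ℝ) (x : PiLp 2 (fun _ : V => E)) (r : V) :
    signedLaplacian G ε x r = ∑ r' ∈ G.neighborFinset r, (x r + ε • x r') := rfl

/-- Swapping the two ends of every edge, with `ε² = 1`, gives a second expression for the same inner
product; the sum is a form over oriented edges, from which symmetry and positivity are visible. -/
theorem two_mul_inner_signedLaplacian {ε : ℝ} (hε : ε * ε = 1) (x y : PiLp 2 (fun _ : V => E)) :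
    2 * inner ℝ (signedLaplacian G ε x) y
      = ∑ r, ∑ r' ∈ G.neighborFinset r, inner ℝ (x r + ε • x r') (y r + ε • y r') := by
  have h1 : inner ℝ (signedLaplacian G ε x) y
      = ∑ r, ∑ r' ∈ G.neighborFinset r, inner ℝ (x r + ε • x r') (y r) := by
    simp only [PiLp.inner_apply, signedLaplacian_apply, sum_inner]
  have h2 : inner ℝ (signedLaplacian G ε x) y
      = ∑ r, ∑ r' ∈ G.neighborFinset r, inner ℝ (x r + ε • x r') (ε • y r') := by
    rw [h1, sum_neighborFinset_comm]
    refine Finset.sum_congr rfl fun r _ => Finset.sum_congr rfl fun r' _ => ?_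
    simp only [inner_add_left, real_inner_smul_left, real_inner_smul_right]
    linear_combination (-inner ℝ (x r') (y r')) * hε
  simp only [inner_add_right (_ + _), Finset.sum_add_distrib]
  rw [← h1, ← h2]; ring

theorem inner_signedLaplacian_symm {ε : ℝ} (hε : ε * ε = 1) (x y : PiLp 2 (fun _ : V => E)) :
    inner ℝ (signedLaplacian G ε x) y = inner ℝ x (signedLaplacian G ε y) := by
  rw [real_inner_comm _ x]
  have h1 := two_mul_inner_signedLaplacian G hε x y
  have h2 := two_mul_inner_signedLaplacian G hε y x
  have h3 : ∑ r, ∑ r' ∈ G.neighborFinset r, inner ℝ (x r + ε • x r') (y r + ε • y r')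
      = ∑ r, ∑ r' ∈ G.neighborFinset r, inner ℝ (y r + ε • y r') (x r + ε • x r') :=
    Finset.sum_congr rfl fun r _ => Finset.sum_congr rfl fun r' _ => real_inner_comm _ _
  linarith

theorem inner_signedLaplacian_nonneg {ε : ℝ} (hε : ε * ε = 1) (x : PiLp 2 (fun _ : V => E)) :
    0 ≤ inner ℝ (signedLaplacian G ε x) x := by
  have h1 := two_mul_inner_signedLaplacian G hε x x
  have : 0 ≤ ∑ r, ∑ r' ∈ G.neighborFinset r, inner ℝ (x r + ε • x r') (x r + ε • x r') :=
    Finset.sum_nonneg fun r _ => Finset.sum_nonneg fun r' _ => real_inner_self_nonneg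
  linarith

variable {G}

/-- The edge form vanishes, so each edge term does; equality then propagates along walks. -/
theorem eq_of_signedLaplacian_eq_zero (hG : G.Connected) {x : PiLp 2 (fun _ : V => E)}
    (hx : signedLaplacian G (-1) x = 0) (r r' : V) : x r = x r' := by
  have h := two_mul_inner_signedLaplacian G (ε := -1) (by norm_num) x x
  rw [hx, inner_zero_left, mul_zero, eq_comm, Finset.sum_eq_zero_iff_of_nonneg
    fun r _ => Finset.sum_nonneg fun r' _ => real_inner_self_nonneg] at h
  have hadj : ∀ a b, G.Adj a b → x a = x b := fun a b hab => by
    have h1 := h a (Finset.mem_univ a)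
    rw [Finset.sum_eq_zero_iff_of_nonneg fun r' _ => real_inner_self_nonneg] at h1
    have h2 := inner_self_eq_zero.1 (h1 b (by simpa using hab))
    rwa [neg_one_smul, ← sub_eq_add_neg, sub_eq_zero] at h2
  obtain ⟨w⟩ := hG.preconnected r r'
  induction w with
  | nil => rfl
  | cons hab _ ih => exact (hadj _ _ hab).trans ih

theorem sum_signedLaplacian (x : PiLp 2 (fun _ : V => E)) :
    ∑ r, signedLaplacian G (-1) x r = 0 := by
  simp only [signedLaplacian_apply, neg_one_smul, Finset.sum_add_distrib, Finset.sum_neg_distrib]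
  rw [sum_neighborFinset_comm G fun r r' => x r', add_neg_cancel]

/-- By symmetry the range is the orthogonal complement of the kernel, that is, of the constant
families. -/
theorem mem_range_signedLaplacian [FiniteDimensional ℝ E] (hG : G.Connected)
    {p : PiLp 2 (fun _ : V => E)} (hp : ∑ r, p r = 0) :
    p ∈ LinearMap.range (signedLaplacian (E := E) G (-1)) := by
  have hsymm : (signedLaplacian (E := E) G (-1)).IsSymmetric :=
    inner_signedLaplacian_symm G (by norm_num)
  rw [← Submodule.orthogonal_orthogonal (LinearMap.range _), hsymm.orthogonal_range]
  intro x hx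
  obtain ⟨r₀⟩ := hG.nonempty
  have hx' := eq_of_signedLaplacian_eq_zero hG (LinearMap.mem_ker.1 hx)
  rw [PiLp.inner_apply, Finset.sum_congr rfl fun r _ => by rw [hx' r r₀], ← inner_sum, hp,
    inner_zero_right]

end GraphOperators

/-! ### Subgradients and consensus optimization -/

section Consensus

open Filter Topology

variable {E : Type*} [NormedAddCommGroup E] [InnerProductSpace ℝ E]

/-- `s` is a subgradient of `f` at `z`. -/
def IsSubgradient (f : E → ℝ) (z s : E) : Prop :=
  ∀ w, f z + inner ℝ s (w - z) ≤ f w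

theorem IsSubgradient.inner_sub_nonneg {f : E → ℝ} {x y s t : E} (hs : IsSubgradient f x s)
    (ht : IsSubgradient f y t) : 0 ≤ inner ℝ (s - t) (x - y) := by
  have h1 := hs y
  have h2 := ht x
  rw [← neg_sub, inner_neg_right] at h1
  rw [inner_sub_left]
  linarith

theorem IsSubgradient.of_tendsto {f : E → ℝ} (hf : Continuous f) {x s : ℕ → E} {x₀ s₀ : E}
    (hx : Tendsto x atTop (𝓝 x₀)) (hs : Tendsto s atTop (𝓝 s₀))
    (h : ∀ k, IsSubgradient f (x k) (s k)) : IsSubgradient f x₀ s₀ := fun w =>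
  le_of_tendsto (((hf.tendsto x₀).comp hx).add (hs.inner (hx.const_sub w)))
    (Eventually.of_forall fun k => h k w)

/-- Convergence of consensus optimization over a connected graph with monotone local gradients
`φ r` and common regularizer `f / |V|`. -/
theorem exists_tendsto_of_consensus_iteration [FiniteDimensional ℝ E] {V : Type*} [Fintype V]
    {G : SimpleGraph V} [DecidableRel G.Adj] (hG : G.Connected) {c : ℝ} (hc : 0 < c)
    {f : E → ℝ} (hf : Continuous f) {φ : V → E → E} (hφc : ∀ r, Continuous (φ r))
    (hφ : ∀ r x y, 0 ≤ inner ℝ (φ r x - φ r y) (x - y))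
    {x g p v : ℕ → V → E} (hp0 : ∑ r, p 0 r = 0)
    (hp : ∀ k r, p (k + 1) r
      = p k r + c • ∑ r' ∈ G.neighborFinset r, (x (k + 1) r - x (k + 1) r'))
    (hv : ∀ k r, v (k + 1) r = v k r + c • (x (k + 1) r - g (k + 1) r))
    (hvφ : ∀ k r, v k r = φ r (g k r))
    (hx : ∀ k r, IsSubgradient f (x (k + 1) r) ((Fintype.card V : ℝ) •
      (-p (k + 1) r - v (k + 1) r + c • (g k r - g (k + 1) r)
        + c • ∑ r' ∈ G.neighborFinset r, ((x k r - x (k + 1) r) + (x k r' - x (k + 1) r')))))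
    (hopt : ∃ z, IsSubgradient f z (-∑ r, φ r z)) :
    ∃ z, IsSubgradient f z (-∑ r, φ r z) ∧ ∀ r, Tendsto (fun k => x k r) atTop (𝓝 z) := by
  have hcard : 0 < (Fintype.card V : ℝ) := by
    have := hG.nonempty
    exact_mod_cast Fintype.card_pos
  let L := (signedLaplacian (E := E) G (-1)).toContinuousLinearMap
  let Q := (signedLaplacian (E := E) G 1).toContinuousLinearMap
  let B : PiLp 2 (fun _ : V => E) → PiLp 2 (fun _ : V => E) → Prop := fun a s =>
    ∀ r, IsSubgradient f (a r) ((Fintype.card V : ℝ) • s r)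
  let Φ : PiLp 2 (fun _ : V => E) → PiLp 2 (fun _ : V => E) := fun a =>
    WithLp.toLp 2 fun r => φ r (a r)
  have hL1 : (-1 : ℝ) * -1 = 1 := by norm_num
  have hQ1 : (1 : ℝ) * 1 = 1 := by norm_num
  have hcoord : ∀ r, Continuous fun a : PiLp 2 (fun _ : V => E) => a r := fun r => by fun_prop
  have key := exists_tendsto_of_splitting_iteration (L := L) (Q := Q) hc
    (inner_signedLaplacian_symm G hL1) (inner_signedLaplacian_nonneg G hL1)
    (inner_signedLaplacian_symm G hQ1) (inner_signedLaplacian_nonneg G hQ1) (φ := Φ)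
    (fun a b => by
      rw [PiLp.inner_apply]
      exact Finset.sum_nonneg fun r _ => hφ r _ _)
    (by fun_prop) (B := B)
    (fun a b s t hs ht => by
      rw [PiLp.inner_apply]
      refine Finset.sum_nonneg fun r _ => ?_
      have h := (hs r).inner_sub_nonneg (ht r)
      rw [← smul_sub, real_inner_smul_left] at h
      exact nonneg_of_mul_nonneg_right h hcard)
    (fun a s a₀ s₀ ha hs h r => IsSubgradient.of_tendsto hf (((hcoord r).tendsto a₀).comp ha)
      ((((hcoord r).tendsto s₀).comp hs).const_smul _) fun k => h k r)
    (x := fun k => WithLp.toLp 2 (x k)) (g := fun k => WithLp.toLp 2 (g k))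
    (p := fun k => WithLp.toLp 2 (p k)) (v := fun k => WithLp.toLp 2 (v k))
    (mem_range_signedLaplacian hG hp0)
    (fun k => by
      ext1 r
      simp [L, hp, sub_eq_add_neg])
    (fun k => by
      ext1 r
      simp [hv])
    (fun k => by
      ext1 r
      simp [Φ, hvφ])
    (fun k r => by
      have := hx k r
      simpa [Q, ← Finset.sum_sub_distrib, add_sub_add_comm] using this)
    (by
      obtain ⟨z, hz⟩ := hopt
      refine ⟨WithLp.toLp 2 fun _ => z,
        -- The multiplier replaces each local gradient by the average one: it has zero sum, and `-p₀
        -- - Φ z` becomes the same vector at every node.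
        WithLp.toLp 2 fun r => -φ r z + (Fintype.card V : ℝ)⁻¹ • ∑ r, φ r z, ?_, ?_, ?_⟩
      · ext1 r
        simp [L]
      · refine mem_range_signedLaplacian hG ?_
        simp [Finset.sum_add_distrib, ← Nat.cast_smul_eq_nsmul ℝ, smul_smul, hcard.ne']
      · intro r
        simpa [Φ, smul_smul, hcard.ne', smul_neg] using hz)
  obtain ⟨z, p₀, hz, ⟨b, hb⟩, hBz, hlim⟩ := key
  obtain ⟨r₀⟩ := hG.nonempty
  have hconst : ∀ r, z r = z r₀ := fun r => eq_of_signedLaplacian_eq_zero hG hz r r₀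
  refine ⟨z r₀, fun w => ?_, fun r => ?_⟩
  -- Summing the local subgradient inequalities eliminates `p₀`, whose sum is zero.
  · have hsum := Finset.sum_le_sum fun r (_ : r ∈ Finset.univ) => hBz r w
    have hp₀ : ∑ r, p₀ r = 0 := by
      rw [← hb]; exact sum_signedLaplacian b
    have e : ∑ r, inner ℝ ((Fintype.card V : ℝ) • ((-p₀ - Φ z) r)) (w - z r₀)
        = (Fintype.card V : ℝ) * inner ℝ (-∑ r, φ r (z r₀)) (w - z r₀) := by
      rw [← sum_inner, ← Finset.smul_sum, real_inner_smul_left]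
      congr 2
      simp [Φ, hp₀, hconst]
    simp only [hconst] at hsum
    rw [Finset.sum_add_distrib, e] at hsum
    simp only [Finset.sum_const, Finset.card_univ, nsmul_eq_mul, ← mul_add] at hsum
    exact le_of_mul_le_mul_left hsum hcard
  · rw [← hconst r]
    exact ((hcoord r).tendsto z).comp hlim

end Consensus

/-! ### Least squares and first-order optimality -/

section LeastSquares

open Filter Topology

variable {E : Type*} [NormedAddCommGroup E] [InnerProductSpace ℝ E] [FiniteDimensional ℝ E]
  {ι : Type*} [Fintype ι] {F : ι → Type*} [∀ i, NormedAddCommGroup (F i)]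
  [∀ i, InnerProductSpace ℝ (F i)]

/-- The gradient of `z ↦ ‖y - T z‖² / 2`. -/
noncomputable def leastSquaresGrad {F : Type*} [NormedAddCommGroup F] [InnerProductSpace ℝ F]
    [FiniteDimensional ℝ F] (T : E →ₗ[ℝ] F) (y : F) (z : E) : E :=
  LinearMap.adjoint T (T z - y)

theorem inner_leastSquaresGrad {F : Type*} [NormedAddCommGroup F] [InnerProductSpace ℝ F]
    [FiniteDimensional ℝ F] (T : E →ₗ[ℝ] F) (y : F) (z h : E) :
    inner ℝ (leastSquaresGrad T y z) h = inner ℝ (T z - y) (T h) :=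
  LinearMap.adjoint_inner_left _ _ _

theorem continuous_leastSquaresGrad {F : Type*} [NormedAddCommGroup F] [InnerProductSpace ℝ F]
    [FiniteDimensional ℝ F] (T : E →ₗ[ℝ] F) (y : F) : Continuous (leastSquaresGrad T y) := by
  have h1 := T.continuous_of_finiteDimensional
  have h2 := (LinearMap.adjoint T).continuous_of_finiteDimensional
  unfold leastSquaresGrad
  fun_prop

theorem inner_leastSquaresGrad_sub_nonneg {F : Type*} [NormedAddCommGroup F]
    [InnerProductSpace ℝ F] [FiniteDimensional ℝ F] (T : E →ₗ[ℝ] F) (y : F) (a b : E) :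
    0 ≤ inner ℝ (leastSquaresGrad T y a - leastSquaresGrad T y b) (a - b) := by
  rw [inner_sub_left, inner_leastSquaresGrad, inner_leastSquaresGrad, ← inner_sub_left,
    sub_sub_sub_cancel_right, ← map_sub]
  exact real_inner_self_nonneg

variable (T : ∀ i, E →ₗ[ℝ] F i) (y : ∀ i, F i)

/-- Project the stacked data onto the range of the stacked map. No coercivity is needed, so this
covers `μ = 0`. -/
theorem exists_forall_sum_norm_sub_sq_le :
    ∃ z, ∀ w, ∑ i, ‖y i - T i z‖ ^ 2 ≤ ∑ i, ‖y i - T i w‖ ^ 2 := by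
  let S : E →ₗ[ℝ] PiLp 2 F :=
    { toFun := fun z => WithLp.toLp 2 fun i => T i z
      map_add' := fun a b => by ext1 i; simp
      map_smul' := fun a b => by ext1 i; simp }
  let Y : PiLp 2 F := WithLp.toLp 2 y
  have hS : ∀ w, ∑ i, ‖y i - T i w‖ ^ 2 = ‖Y - S w‖ ^ 2 := fun w => by
    rw [PiLp.norm_sq_eq_of_L2]; rfl
  obtain ⟨z, hz⟩ := (LinearMap.range S).starProjection_apply_mem Y
  refine ⟨z, fun w => ?_⟩
  rw [hS, hS, hz, Submodule.starProjection_minimal]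
  gcongr
  · exact Real.iInf_nonneg fun _ => norm_nonneg _
  · exact ciInf_le (f := fun x : LinearMap.range S => ‖Y - x‖)
      ⟨0, by rintro _ ⟨_, rfl⟩; exact norm_nonneg _⟩ ⟨S w, w, rfl⟩

variable [∀ i, FiniteDimensional ℝ (F i)]

theorem sum_norm_sub_sq_add (z h : E) :
    1 / 2 * ∑ i, ‖y i - T i (z + h)‖ ^ 2 = 1 / 2 * ∑ i, ‖y i - T i z‖ ^ 2
      + inner ℝ (∑ i, leastSquaresGrad (T i) (y i) z) h + 1 / 2 * ∑ i, ‖T i h‖ ^ 2 := by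
  rw [sum_inner, Finset.mul_sum, Finset.mul_sum, Finset.mul_sum, ← Finset.sum_add_distrib,
    ← Finset.sum_add_distrib]
  refine Finset.sum_congr rfl fun i _ => ?_
  have h1 : y i - T i (z + h) = -(T i z - y i + T i h) := by rw [map_add]; abel
  rw [inner_leastSquaresGrad, h1, norm_neg, norm_add_sq_real, norm_sub_rev (y i)]
  ring

/-- First-order optimality for a composite least-squares cost. -/
theorem isSubgradient_iff_forall_le {f : E → ℝ} (hf : ConvexOn ℝ Set.univ f) (z : E) :
    IsSubgradient f z (-∑ i, leastSquaresGrad (T i) (y i) z) ↔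
      ∀ w, 1 / 2 * ∑ i, ‖y i - T i z‖ ^ 2 + f z ≤ 1 / 2 * ∑ i, ‖y i - T i w‖ ^ 2 + f w := by
  constructor
  · intro h w
    have h1 := h w
    have h2 := sum_norm_sub_sq_add T y z (w - z)
    rw [add_sub_cancel] at h2
    have h3 : 0 ≤ ∑ i, ‖T i (w - z)‖ ^ 2 := Finset.sum_nonneg fun i _ => by positivity
    rw [inner_neg_left] at h1
    linarith
  · intro h w
    rw [inner_neg_left]
    set a := inner ℝ (∑ i, leastSquaresGrad (T i) (y i) z) (w - z)
    set q := 1 / 2 * ∑ i, ‖T i (w - z)‖ ^ 2 with hq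
    -- Compare with the point `z + t • (w - z)`, use convexity of `f`, divide by `t`; letting `t →
    -- 0` removes the quadratic remainder.
    have key : ∀ t ∈ Set.Ioo (0 : ℝ) 1, 0 ≤ a + f w - f z + t * q := by
      rintro t ⟨ht0, ht1⟩
      have h1 := h (z + t • (w - z))
      rw [sum_norm_sub_sq_add, real_inner_smul_right] at h1
      simp only [map_smul, norm_smul, mul_pow, Real.norm_eq_abs, sq_abs] at h1
      rw [← Finset.mul_sum] at h1
      have h2 := hf.2 (Set.mem_univ z) (Set.mem_univ w) (sub_nonneg.2 ht1.le) ht0.le (by ring)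
      have h3 : (1 - t) • z + t • w = z + t • (w - z) := by
        rw [sub_smul, one_smul, smul_sub]; abel
      rw [h3, smul_eq_mul, smul_eq_mul] at h2
      have h4 : 0 ≤ t * (a + f w - f z + t * q) := by
        rw [hq]; linarith
      exact nonneg_of_mul_nonneg_right h4 ht0
    have hlim : Tendsto (fun t : ℝ => a + f w - f z + t * q) (𝓝[>] 0) (𝓝 (a + f w - f z)) := by
      have : Continuous fun t : ℝ => a + f w - f z + t * q := by fun_prop
      have h5 := (this.tendsto 0).mono_left (nhdsWithin_le_nhds (s := Set.Ioi 0))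
      simpa using h5
    have := ge_of_tendsto hlim (by
      filter_upwards [Ioo_mem_nhdsGT (zero_lt_one' ℝ)] with t ht using key t ht)
    linarith

end LeastSquares

/-! ### The group-Lasso updates as optimality conditions -/

section GroupLasso

open Filter Topology DGLasso

/-- Soft-thresholding is the proximal map of `μ‖·‖`. The residual is `u` itself when `‖u‖ ≤ μ`, and
otherwise `μ u / ‖u‖`; both cases reduce to Cauchy–Schwarz. -/
theorem softThreshold_isSubgradient {μ : ℝ} (hμ : 0 ≤ μ) {m : ℕ} (u : EuclideanSpace ℝ (Fin m)) :
    IsSubgradient (fun w => μ * ‖w‖) (softThreshold μ u) (u - softThreshold μ u) := by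
  intro w
  rcases le_or_gt ‖u‖ μ with h | h
  · have h0 : softThreshold μ u = 0 := by
      rw [softThreshold, max_eq_right (by linarith), zero_smul]
    rw [h0]
    simp only [norm_zero, mul_zero, sub_zero, zero_add]
    exact (real_inner_le_norm u w).trans (by gcongr)
  · have hu : 0 < ‖u‖ := hμ.trans_lt h
    have h0 : softThreshold μ u = (1 - μ * ‖u‖⁻¹) • u := by
      rw [softThreshold, max_eq_left (by linarith), smul_smul, sub_mul, mul_inv_cancel₀ hu.ne']
    have hle : μ * ‖u‖⁻¹ ≤ 1 := by
      rw [← div_eq_mul_inv]; exact (div_le_one hu).2 h.le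
    have h1 : u - softThreshold μ u = (μ * ‖u‖⁻¹) • u := by
      rw [h0, sub_smul, one_smul, sub_sub_cancel]
    have hn : ‖(1 - μ * ‖u‖⁻¹) • u‖ = (1 - μ * ‖u‖⁻¹) * ‖u‖ := by
      rw [norm_smul, Real.norm_of_nonneg (by linarith)]
    simp only
    rw [h1, h0, inner_sub_right, hn, real_inner_smul_left, real_inner_smul_left,
      real_inner_smul_right, real_inner_self_eq_norm_sq]
    have h2 : μ * ‖u‖⁻¹ * inner ℝ u w ≤ μ * ‖u‖⁻¹ * (‖u‖ * ‖w‖) := by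
      gcongr
      exact real_inner_le_norm u w
    have h3 : μ * ‖u‖⁻¹ * (‖u‖ * ‖w‖) = μ * ‖w‖ := by field_simp
    have h4 : μ * ‖u‖⁻¹ * ((1 - μ * ‖u‖⁻¹) * ‖u‖ ^ 2) = μ * ((1 - μ * ‖u‖⁻¹) * ‖u‖) := by
      field_simp
    linarith

/-- Positive homogeneity of the norm: test the unscaled inequality at `β • w` and cancel `β`. -/
theorem inv_smul_softThreshold_isSubgradient {μ β : ℝ} (hμ : 0 ≤ μ) (hβ : 0 < β) {m : ℕ}
    (u : EuclideanSpace ℝ (Fin m)) :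
    IsSubgradient (fun w => μ * ‖w‖) (β⁻¹ • softThreshold μ u)
      (u - β • (β⁻¹ • softThreshold μ u)) := by
  intro w
  have h := softThreshold_isSubgradient hμ u (β • w)
  have e : softThreshold μ u = β • (β⁻¹ • softThreshold μ u) := by
    rw [smul_smul, mul_inv_cancel₀ hβ.ne', one_smul]
  set s := β⁻¹ • softThreshold μ u
  rw [e] at h
  simp only [← smul_sub β w, norm_smul, Real.norm_of_nonneg hβ.le, real_inner_smul_right] at h
  refine le_of_mul_le_mul_left ?_ hβ
  simp only
  linarith

variable {Nr Nb : ℕ} {d : Fin Nb → ℕ} {n : Fin Nr → ℕ}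

theorem inner_eq_sum_inner_group (a b : Param d) :
    inner ℝ a b = ∑ ν, inner ℝ (group a ν) (group b ν) := by
  simp only [PiLp.inner_apply, Fintype.sum_sigma, group]

theorem norm_sq_eq_sum_norm_group_sq (a : Param d) : ‖a‖ ^ 2 = ∑ ν, ‖group a ν‖ ^ 2 := by
  simp only [← real_inner_self_eq_norm_sq, inner_eq_sum_inner_group]

theorem group_add (a b : Param d) (ν : Fin Nb) : group (a + b) ν = group a ν + group b ν := rfl

theorem group_sub (a b : Param d) (ν : Fin Nb) : group (a - b) ν = group a ν - group b ν := rfl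

theorem group_smul (t : ℝ) (a : Param d) (ν : Fin Nb) : group (t • a) ν = t • group a ν := rfl

theorem norm_le_sum_norm_group (a : Param d) : ‖a‖ ≤ ∑ ν, ‖group a ν‖ := by
  refine (sq_le_sq₀ (norm_nonneg _) (Finset.sum_nonneg fun _ _ => norm_nonneg _)).1 ?_
  rw [norm_sq_eq_sum_norm_group_sq]
  exact Finset.sum_sq_le_sq_sum_of_nonneg fun _ _ => norm_nonneg _

/-- The group-Lasso penalty. -/
noncomputable def groupPenalty (μ : ℝ) (z : Param d) : ℝ := μ * ∑ ν, ‖group z ν‖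

theorem continuous_groupPenalty (μ : ℝ) : Continuous (groupPenalty μ : Param d → ℝ) := by
  unfold groupPenalty group
  fun_prop

theorem convexOn_groupPenalty {μ : ℝ} (hμ : 0 ≤ μ) :
    ConvexOn ℝ Set.univ (groupPenalty μ : Param d → ℝ) := by
  refine ⟨convex_univ, fun a _ b _ s t hs ht _ => ?_⟩
  simp only [groupPenalty, smul_eq_mul, group_add, group_smul]
  have h : ∑ ν, ‖s • group a ν + t • group b ν‖
      ≤ ∑ ν, (s * ‖group a ν‖ + t * ‖group b ν‖) := by
    refine Finset.sum_le_sum fun ν _ => (norm_add_le _ _).trans_eq ?_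
    rw [norm_smul, norm_smul, Real.norm_of_nonneg hs, Real.norm_of_nonneg ht]
  rw [Finset.sum_add_distrib, ← Finset.mul_sum, ← Finset.mul_sum] at h
  linarith [mul_le_mul_of_nonneg_left h hμ]

theorem isSubgradient_groupPenalty {μ : ℝ} {z s : Param d}
    (h : ∀ ν, IsSubgradient (fun w => μ * ‖w‖) (group z ν) (group s ν)) :
    IsSubgradient (groupPenalty μ) z s := by
  intro w
  rw [groupPenalty, groupPenalty, inner_eq_sum_inner_group, Finset.mul_sum, Finset.mul_sum,
    ← Finset.sum_add_distrib]
  exact Finset.sum_le_sum fun ν _ => h ν (group w ν)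

/-- The linear map `z ↦ X_r z`. -/
noncomputable abbrev designMap {m : ℕ} (X : Matrix (Fin m) (Σ ν : Fin Nb, Fin (d ν)) ℝ) :
    Param d →ₗ[ℝ] EuclideanSpace ℝ (Fin m) :=
  Matrix.toEuclideanLin X

theorem leastSquaresGrad_designMap {m : ℕ} (X : Matrix (Fin m) (Σ ν : Fin Nb, Fin (d ν)) ℝ)
    (y : EuclideanSpace ℝ (Fin m)) (z : Param d) :
    leastSquaresGrad (designMap X) y z = WithLp.toLp 2 (Xᵀ *ᵥ (X *ᵥ z.ofLp - y.ofLp)) := by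
  rw [leastSquaresGrad, ← Matrix.toEuclideanLin_conjTranspose_eq_adjoint,
    Matrix.conjTranspose_eq_transpose_of_trivial]
  rfl

variable (G : SimpleGraph (Fin Nr)) [DecidableRel G.Adj]
  (y : (r : Fin Nr) → EuclideanSpace ℝ (Fin (n r)))
  (X : (r : Fin Nr) → Matrix (Fin (n r)) (Σ ν : Fin Nb, Fin (d ν)) ℝ)
  (μ c : ℝ)

theorem cost_eq (z : Param d) : cost y X μ z
    = 1 / 2 * ∑ r, ‖y r - designMap (X r) z‖ ^ 2 + groupPenalty μ z := rfl

variable {μ c}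

theorem solutionSet_nonempty (hμ : 0 ≤ μ) : (solutionSet y X μ).Nonempty := by
  -- Coercivity comes from the penalty alone, so it fails as an argument at `μ = 0`.
  rcases hμ.eq_or_lt with rfl | hμ
  · obtain ⟨z, hz⟩ := exists_forall_sum_norm_sub_sq_le (fun r => designMap (X r)) y
    refine ⟨z, fun w => ?_⟩
    rw [cost_eq, cost_eq, groupPenalty, groupPenalty, zero_mul, zero_mul]
    linarith [hz w]
  · have hcont : Continuous (cost y X μ) := by
      have h := fun r => (designMap (X r)).continuous_of_finiteDimensional
      have h' := continuous_groupPenalty (d := d) μ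
      simp only [funext (cost_eq y X μ)]
      fun_prop
    have hlim : Tendsto (cost y X μ) (cocompact _) atTop := by
      refine tendsto_atTop_mono (fun z => ?_)
        ((tendsto_norm_cocompact_atTop (E := Param d)).const_mul_atTop hμ)
      have h1 : 0 ≤ ∑ r, ‖y r - designMap (X r) z‖ ^ 2 :=
        Finset.sum_nonneg fun _ _ => by positivity
      have h2 := mul_le_mul_of_nonneg_left (norm_le_sum_norm_group z) hμ.le
      rw [cost_eq, groupPenalty]
      linarith
    exact hcont.exists_forall_le hlim

theorem mem_solutionSet_iff (hμ : 0 ≤ μ) (z : Param d) : z ∈ solutionSet y X μ ↔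
    IsSubgradient (groupPenalty μ) z (-∑ r, leastSquaresGrad (designMap (X r)) (y r) z) :=
  (isSubgradient_iff_forall_le (fun r => designMap (X r)) y (convexOn_groupPenalty hμ) z).symm

/-- The normal equations for the new `γ`, rearranged, are the next `v` update. -/
theorem leastSquaresGrad_nextGamma (hc : 0 < c) (s : State Nr d) (r : Fin Nr) :
    leastSquaresGrad (designMap (X r)) (y r) (nextGamma G y X μ c s r)
      = nextV c (step G y X μ c s) r := by
  set M : Matrix (Σ ν : Fin Nb, Fin (d ν)) (Σ ν : Fin Nb, Fin (d ν)) ℝ :=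
    c • (1 : Matrix (Σ ν : Fin Nb, Fin (d ν)) (Σ ν : Fin Nb, Fin (d ν)) ℝ) + (X r)ᵀ * X r with hM
  have hpd : M.PosDef := by
    refine (Matrix.PosDef.one.smul hc).add_posSemidef ?_
    simpa using Matrix.posSemidef_conjTranspose_mul_self (X r)
  have hdet : IsUnit M.det := (Matrix.isUnit_iff_isUnit_det M).1 hpd.isUnit
  have hsolve : M *ᵥ (nextGamma G y X μ c s r).ofLp
      = (X r)ᵀ *ᵥ (y r).ofLp + (c • nextZeta G μ c s r + nextV c s r).ofLp := by
    rw [nextGamma, Matrix.mulVec_mulVec, Matrix.mul_nonsing_inv _ hdet, Matrix.one_mulVec]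
  rw [hM, Matrix.add_mulVec, Matrix.smul_mulVec, Matrix.one_mulVec, ← Matrix.mulVec_mulVec] at hsolve
  rw [leastSquaresGrad_designMap, Matrix.mulVec_sub]
  ext i
  have := congrFun hsolve i
  simp [nextV, step] at this ⊢
  linarith

/-- Substituting the next `p` and `v` cancels the new `γ`, and Laplacian plus signless Laplacian
leaves the new `ζ` with coefficient `c (2 deg r + 1)`: the neighbors' new values drop out. -/
theorem nextZeta_isSubgradient (hμ : 0 ≤ μ) (hc : 0 < c) (s : State Nr d) (r : Fin Nr) :
    IsSubgradient (groupPenalty μ) (nextZeta G μ c s r) ((Nr : ℝ) •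
      (-nextP G c (step G y X μ c s) r - nextV c (step G y X μ c s) r
        + c • (s.γ r - nextGamma G y X μ c s r)
        + c • ∑ r' ∈ G.neighborFinset r, ((s.ζ r - nextZeta G μ c s r)
          + (s.ζ r' - nextZeta G μ c s r')))) := by
  have hNr : 0 < (Nr : ℝ) := by exact_mod_cast r.pos
  set β := c * (Nr : ℝ) * (2 * (G.degree r : ℝ) + 1) with hβ
  have hβ0 : 0 < β := by positivity
  set a := c • s.γ r + c • ∑ r' ∈ G.neighborFinset r, (s.ζ r + s.ζ r')
    - nextP G c s r - nextV c s r with ha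
  have e : (Nr : ℝ) • (-nextP G c (step G y X μ c s) r - nextV c (step G y X μ c s) r
        + c • (s.γ r - nextGamma G y X μ c s r)
        + c • ∑ r' ∈ G.neighborFinset r, ((s.ζ r - nextZeta G μ c s r)
          + (s.ζ r' - nextZeta G μ c s r')))
      = (Nr : ℝ) • a - β • nextZeta G μ c s r := by
    have : β • nextZeta G μ c s r
        = (Nr : ℝ) • ((c * (2 * (G.degree r : ℝ) + 1)) • nextZeta G μ c s r) := by
      rw [smul_smul, hβ]; congr 1; ring
    rw [this, ← smul_sub, ha]
    congr 1
    rw [nextP, nextV]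
    simp only [step, Finset.sum_add_distrib, Finset.sum_sub_distrib, Finset.sum_const,
      SimpleGraph.card_neighborFinset_eq_degree, ← Nat.cast_smul_eq_nsmul ℝ]
    module
  rw [e]
  refine isSubgradient_groupPenalty fun ν => ?_
  have hg : group (nextZeta G μ c s r) ν
      = β⁻¹ • softThreshold μ (group ((Nr : ℝ) • a) ν) := rfl
  rw [group_sub, group_smul β, hg]
  exact inv_smul_softThreshold_isSubgradient hμ hβ0 _

theorem exists_tendsto_iterates (hG : G.Connected) (hμ : 0 ≤ μ) (hc : 0 < c) (s : State Nr d)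
    (hs : ∑ r, s.p r = 0) :
    ∃ z ∈ solutionSet y X μ, ∀ r : Fin Nr,
      Tendsto (fun k : ℕ => (iterates G y X μ c s k).ζ r) atTop (𝓝 z) := by
  obtain ⟨z, hz, hlim⟩ := exists_tendsto_of_consensus_iteration (E := Param d) hG hc
    (continuous_groupPenalty μ)
    (φ := fun r => leastSquaresGrad (designMap (X r)) (y r))
    (fun r => continuous_leastSquaresGrad _ _)
    (fun r => inner_leastSquaresGrad_sub_nonneg _ _)
    -- One iteration is dropped because the initial `γ` and `v` are arbitrary and need not satisfy
    -- `v = φ γ`. States store `p` and `v` with a lag of one, hence `k + 2`.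
    (x := fun k => (iterates G y X μ c s (k + 1)).ζ)
    (g := fun k => (iterates G y X μ c s (k + 1)).γ)
    (p := fun k => (iterates G y X μ c s (k + 2)).p)
    (v := fun k => (iterates G y X μ c s (k + 2)).v)
    (by
      have hp : ∀ t : State Nr d, ∑ r, t.p r = 0 → ∑ r, nextP G c t r = 0 := fun t ht => by
        simp only [nextP, Finset.sum_add_distrib, ht, ← Finset.smul_sum, Finset.sum_sub_distrib]
        rw [sum_neighborFinset_comm G fun r r' => t.ζ r', sub_self, smul_zero, add_zero]
      exact hp _ (hp _ hs))
    (fun k r => rfl) (fun k r => rfl)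
    (fun k r => (leastSquaresGrad_nextGamma G y X hc _ r).symm)
    (fun k r => by
      rw [Fintype.card_fin]
      exact nextZeta_isSubgradient G y X hμ hc _ r)
    (by
      obtain ⟨z, hz⟩ := solutionSet_nonempty y X hμ
      exact ⟨z, (mem_solutionSet_iff y X hμ z).1 hz⟩)
  exact ⟨z, (mem_solutionSet_iff y X hμ z).2 hz, fun r =>
    (tendsto_add_atTop_iff_nat (f := fun k => (iterates G y X μ c s k).ζ r) 1).1 (hlim r)⟩

end GroupLasso

theorem proposition3 {Nr Nb : ℕ} {d : Fin Nb → ℕ} {n : Fin Nr → ℕ}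
    (G : SimpleGraph (Fin Nr)) [DecidableRel G.Adj] (hG : G.Connected)
    (y : (r : Fin Nr) → EuclideanSpace ℝ (Fin (n r)))
    (X : (r : Fin Nr) → Matrix (Fin (n r)) (Σ ν : Fin Nb, Fin (d ν)) ℝ)
    (μ : ℝ) (hμ : 0 ≤ μ) (c : ℝ) (hc : 0 < c)
    (s : DGLasso.State Nr d) (hs : ∑ r, s.p r = 0) :
    (∃ z ∈ DGLasso.solutionSet y X μ, ∀ r : Fin Nr,
      Filter.Tendsto (fun k : ℕ => (DGLasso.iterates G y X μ c s k).ζ r)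
        Filter.atTop (nhds z)) ∧
    (∀ z : DGLasso.Param d, DGLasso.solutionSet y X μ = {z} → ∀ r : Fin Nr,
      Filter.Tendsto (fun k : ℕ => (DGLasso.iterates G y X μ c s k).ζ r)
        Filter.atTop (nhds z)) := by
  obtain ⟨z, hz, hlim⟩ := exists_tendsto_iterates G y X hG hμ hc s hs
  refine ⟨⟨z, hz, hlim⟩, fun z' hz' => ?_⟩
  rw [hz', Set.mem_singleton_iff] at hz
  exact hz ▸ hlim
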